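/- Let $\mathbb{K}$ be a field of prime characteristic $p$, let $R=\mathbb{K}[[x,y,z]]$, let $I\subseteq R$ be any ideal, and let $S=R/I$. For an ideal $J$ of $R$ let $J^{[p^e]}$ be the ideal generated by all $a^{p^e}$ with $a\in J$, and for $\beta\ge 1$ put $K_\beta=(I^{[p^\beta]}:I)$. Let $E$ be the $R$-module of inverse polynomials, with $\mathbb{K}$-basis the monomials $x^{-i}y^{-j}z^{-k}$, $i,j,k\ge 1$, on which power series act by multiplication, a monomial with some non-negative exponent being read as $0$. Let $f:E\to E$ be the standard Frobenius map, that is, the additive map with $f(\lambda x^{-i}y^{-j}z^{-k})=\lambda^p x^{-pi}y^{-pj}z^{-pk}$. Let $E_S=\{m\in E: Im=0\}$. For an $S$-module $M$ and $e\ge 0$ let $\mathcal{F}^e(M)$ be the group of additive maps $\phi:M\to M$ with $\phi(sm)=s^{p^e}\phi(m)$ for all $s\in S$, $m\in M$, and let $\mathcal{F}(M)=\bigoplus_{e\ge 0}\mathcal{F}^e(M)$ (external direct sum), a ring under composition. For $e\ge 1$ let $\mathcal{F}_{<e}$ be the $S$-subalgebra of $\mathcal{F}(E_S)$ generated by $\mathcal{F}^0(E_S),\dots,\mathcal{F}^{e-1}(E_S)$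 (equivalently the subring, as it contains the image of $S$), and let $$L_e=\sum_{\substack{1\le\beta_1,\dots,\beta_s<e\\ \beta_1+\dots+\beta_s=e}} K_{\beta_1}K_{\beta_2}^{[p^{\beta_1}]}K_{\beta_3}^{[p^{\beta_1+\beta_2}]}\cdots K_{\beta_s}^{[p^{\beta_1+\dots+\beta_{s-1}}]}$$ (an empty sum is the zero ideal). Then $E$ is an injective hull of the residue field of $R$, and if $I\ne R$ then $S$ is local and $E_S$ is an injective hull over $S$ of the residue field of $S$. Moreover, for every $e\ge 1$, $$\mathcal{F}_{<e}\cap\mathcal{F}^e(E_S)=L_e f^e,$$ where $L_ef^e$ is the set of the maps $m\mapsto a f^e(m)$ on $E_S$ with $a\in L_e$; in particular each of these maps sends $E_S$ into $E_S$. -/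

import Mathlib

open scoped DirectSum

universe u v

namespace FrobeniusMaps

/-! ### The algebra of Frobenius maps of a module -/

section Algebra

/-- The additive group of `p ^ e`-Frobenius maps of an `S`-module `M`: additive maps `φ : M → M`
with `φ (s m) = s ^ (p ^ e) φ m`. -/
def frobMaps (S : Type u) [CommRing S] (p : ℕ) (M : Type v) [AddCommGroup M] [Module S M]
    (e : ℕ) : AddSubgroup (AddMonoid.End M) where
  carrier := {φ | ∀ (s : S) (m : M), φ (s • m) = s ^ (p ^ e) • φ m}
  zero_mem' := by
    intro s m
    simp
  add_mem' := by
    intro a b ha hb s m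
    have h1 : a (s • m) = s ^ (p ^ e) • a m := ha s m
    have h2 : b (s • m) = s ^ (p ^ e) • b m := hb s m
    change a (s • m) + b (s • m) = s ^ (p ^ e) • (a m + b m)
    rw [h1, h2, smul_add]
  neg_mem' := by
    intro a ha s m
    have h1 : a (s • m) = s ^ (p ^ e) • a m := ha s m
    change -a (s • m) = s ^ (p ^ e) • -a m
    rw [h1, smul_neg]

/-- Composition of Frobenius maps is additive in the exponent, so that the external direct sum
`⨁ e, frobMaps S p M e` is a (noncommutative) ring whose multiplication is composition. -/
instance frobMaps_gradedMonoid (S : Type u) [CommRing S] (p : ℕ) (M : Type v) [AddCommGroup M]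
    [Module S M] : SetLike.GradedMonoid (frobMaps S p M) where
  one_mem := by
    intro s m
    simp
  mul_mem := by
    intro i j a b ha hb s m
    change ∀ (s : S) (m : M), a (s • m) = s ^ (p ^ i) • a m at ha
    change ∀ (s : S) (m : M), b (s • m) = s ^ (p ^ j) • b m at hb
    change a (b (s • m)) = s ^ (p ^ (i + j)) • a (b m)
    rw [hb, ha, ← pow_mul, ← pow_add, add_comm j i]

/-- The graded ring of all Frobenius maps of `M`, an external direct sum. -/
abbrev FrobAlg (S : Type u) [CommRing S] (p : ℕ) (M : Type v) [AddCommGroup M] [Module S M] :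
    Type v :=
  ⨁ e, frobMaps S p M e

/-- The subalgebra of `FrobAlg S p M` generated by the homogeneous elements of degree `< e`.
For `1 ≤ e` it contains the whole degree-zero part, hence the scalars from `S`,
so the generated subring is the generated `S`-subalgebra. -/
def frobAlgLT (S : Type u) [CommRing S] (p : ℕ) (M : Type v) [AddCommGroup M] [Module S M]
    (e : ℕ) : Subring (FrobAlg S p M) :=
  Subring.closure
    {x | ∃ (i : ℕ) (φ : frobMaps S p M i), i < e ∧
      x = DirectSum.of (fun j => frobMaps S p M j) i φ}

end Algebra

/-! ### Ideals: Frobenius powers, colons, and the ideals `L e` -/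

section Ideals

/-- The Frobenius power `I^[p^e]`, generated by the `p ^ e`-th powers of the elements of `I`. -/
def frobPower {R : Type u} [CommRing R] (p : ℕ) (I : Ideal R) (e : ℕ) : Ideal R :=
  Ideal.span {x | ∃ a ∈ I, x = a ^ (p ^ e)}

/-- The colon ideal `K_e = (I^[p^e] : I)`. -/
def colonIdeal {R : Type u} [CommRing R] (p : ℕ) (I : Ideal R) (e : ℕ) : Ideal R :=
  (frobPower p I e).colon (I : Set R)

/-- The sum over all compositions `β₁ + ⋯ + βₛ = e` with every `βᵢ < e` of the products
`K_{β₁} K_{β₂}^[p^β₁] ⋯ K_{βₛ}^[p^(β₁ + ⋯ + βₛ₋₁)]`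
(`c.sizeUpTo i` is the sum of the blocks of `c` that precede the block `i`). -/
def lIdeal {R : Type u} [CommRing R] (p : ℕ) (I : Ideal R) (e : ℕ) : Ideal R :=
  ⨆ (c : Composition e) (_ : ∀ i : Fin c.length, c.blocksFun i < e),
    ∏ i : Fin c.length, frobPower p (colonIdeal p I (c.blocksFun i)) (c.sizeUpTo i)

end Ideals

/-! ### Injective hulls -/

/-- `M` is an injective hull of `N`: it is injective and an essential extension of `N`. -/
def IsInjectiveHull (A : Type u) [CommRing A] (N M : Type v) [AddCommGroup N] [Module A N]
    [AddCommGroup M] [Module A M] : Prop :=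
  Module.Injective A M ∧
    ∃ j : N →ₗ[A] M, Function.Injective j ∧
      ∀ U : Submodule A M, U ≠ ⊥ → U ⊓ LinearMap.range j ≠ ⊥

/-! ### Power series in three variables and inverse polynomials -/

section InversePolynomials

/-- The power series ring `K⟦x, y, z⟧`. -/
abbrev PS (K : Type u) [Field K] : Type u := MvPowerSeries (Fin 3) K

/-- The module of inverse polynomials, with `K`-basis the monomials `x^(-a) y^(-b) z^(-c)`,
`a, b, c ≥ 1`. Exponents are shifted by one:
`Finsupp.single n c` stands for `c * x^(-(n 0 + 1)) y^(-(n 1 + 1)) z^(-(n 2 + 1))`. -/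
abbrev InvPoly (K : Type u) [Field K] : Type u := (Fin 3 →₀ ℕ) →₀ K

/-- Multiplication by the power series `a` on inverse polynomials: the monomial of exponent `d`
sends the basis element indexed by `k` to the one indexed by `k - d` if `d ≤ k`, and to `0`
otherwise. -/
noncomputable def invPolyMul {K : Type u} [Field K] (a : PS K) : InvPoly K →+ InvPoly K :=
  Finsupp.liftAddHom fun k =>
    ∑ q ∈ Finset.HasAntidiagonal.antidiagonal k,
      (Finsupp.singleAddHom q.2).comp (AddMonoidHom.mulLeft (MvPowerSeries.coeff q.1 a))

theorem invPolyMul_single {K : Type u} [Field K] (a : PS K) (k : Fin 3 →₀ ℕ) (c : K) :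
    invPolyMul a (Finsupp.single k c) =
      ∑ q ∈ Finset.HasAntidiagonal.antidiagonal k,
        Finsupp.single q.2 (MvPowerSeries.coeff q.1 a * c) := by
  rw [invPolyMul, Finsupp.liftAddHom_apply_single, AddMonoidHom.finsetSum_apply]
  rfl

theorem invPoly_hom_ext {K : Type u} [Field K] {f g : InvPoly K →+ InvPoly K}
    (h : ∀ (k : Fin 3 →₀ ℕ) (c : K), f (Finsupp.single k c) =
      g (Finsupp.single k c)) : f = g :=
  Finsupp.addHom_ext h

theorem invPolyMul_one (K : Type u) [Field K] :
    invPolyMul (1 : PS K) = AddMonoidHom.id (InvPoly K) := by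
  classical
  refine invPoly_hom_ext fun k c => ?_
  rw [invPolyMul_single, Finset.sum_eq_single ((0, k) : (Fin 3 →₀ ℕ) × (Fin 3 →₀ ℕ))]
  · simp
  · rintro ⟨d, n⟩ hm hne
    rw [MvPowerSeries.coeff_one, if_neg, zero_mul, Finsupp.single_zero]
    rintro rfl
    simp_all
  · simp

theorem invPolyMul_add {K : Type u} [Field K] (a b : PS K) :
    invPolyMul (a + b) = invPolyMul a + invPolyMul b := by
  refine invPoly_hom_ext fun k c => ?_
  rw [AddMonoidHom.add_apply, invPolyMul_single, invPolyMul_single, invPolyMul_single]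
  refine Eq.trans ?_ Finset.sum_add_distrib
  refine Finset.sum_congr rfl fun q _ => ?_
  rw [map_add, add_mul, Finsupp.single_add]

theorem invPolyMul_mul {K : Type u} [Field K] (a b : PS K) :
    invPolyMul (a * b) = (invPolyMul a).comp (invPolyMul b) := by
  classical
  refine invPoly_hom_ext fun k c => ?_
  rw [AddMonoidHom.comp_apply, invPolyMul_single, invPolyMul_single]
  refine Eq.trans ?_ (map_sum (invPolyMul a) _ _).symm
  simp only [invPolyMul_single, MvPowerSeries.coeff_mul, Finset.sum_mul]
  have h : ∀ q : (Fin 3 →₀ ℕ) × (Fin 3 →₀ ℕ),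
      Finsupp.single q.2 (∑ r ∈ Finset.HasAntidiagonal.antidiagonal q.1,
        MvPowerSeries.coeff r.1 a * MvPowerSeries.coeff r.2 b * c) =
      ∑ r ∈ Finset.HasAntidiagonal.antidiagonal q.1,
        Finsupp.single q.2 (MvPowerSeries.coeff r.1 a * MvPowerSeries.coeff r.2 b * c) :=
    fun q => map_sum (Finsupp.singleAddHom q.2) _ _
  simp only [h]
  rw [Finset.sum_sigma']
  refine Eq.trans ?_ (Finset.sum_sigma' _ _ _).symm
  refine Finset.sum_nbij'
    (fun x => ⟨(x.2.2, x.2.1 + x.1.2), (x.2.1, x.1.2)⟩)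
    (fun x => ⟨(x.2.1 + x.1.1, x.2.2), (x.2.1, x.1.1)⟩) ?_ ?_ ?_ ?_ ?_
  · rintro ⟨⟨d, n⟩, ⟨r, s⟩⟩ hx
    simp only [Finset.mem_sigma, Finset.HasAntidiagonal.mem_antidiagonal] at hx ⊢
    refine ⟨?_, trivial⟩
    rw [← hx.1, ← hx.2]
    abel
  · rintro ⟨⟨d, n⟩, ⟨r, s⟩⟩ hx
    simp only [Finset.mem_sigma, Finset.HasAntidiagonal.mem_antidiagonal] at hx ⊢
    refine ⟨?_, trivial⟩
    rw [← hx.1, ← hx.2]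
    abel
  · rintro ⟨⟨d, n⟩, ⟨r, s⟩⟩ hx
    simp only [Finset.mem_sigma, Finset.HasAntidiagonal.mem_antidiagonal] at hx
    obtain ⟨-, rfl⟩ := hx
    rfl
  · rintro ⟨⟨d, n⟩, ⟨r, s⟩⟩ hx
    simp only [Finset.mem_sigma, Finset.HasAntidiagonal.mem_antidiagonal] at hx
    obtain ⟨-, rfl⟩ := hx
    rfl
  · rintro ⟨⟨d, n⟩, ⟨r, s⟩⟩ -
    simp only [mul_assoc]

noncomputable instance (K : Type u) [Field K] : Module (PS K) (InvPoly K) where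
  smul a m := invPolyMul a m
  one_smul m := DFunLike.congr_fun (invPolyMul_one K) m
  mul_smul a b m := DFunLike.congr_fun (invPolyMul_mul a b) m
  smul_zero a := map_zero (invPolyMul a)
  smul_add a := map_add (invPolyMul a)
  add_smul a b m := DFunLike.congr_fun (invPolyMul_add a b) m
  zero_smul m := by
    have h := DFunLike.congr_fun (invPolyMul_add (0 : PS K) 0) m
    rw [add_zero, AddMonoidHom.add_apply] at h
    exact left_eq_add.mp h

/-- The standard Frobenius map on inverse polynomials, in unshifted exponents
`c x^(-α) y^(-β) z^(-γ) ↦ c^p x^(-p α) y^(-p β) z^(-p γ)`;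
on shifted exponents `n = α - 1` this is `n ↦ p (n + 1) - 1 = p n + (p - 1)`. -/
noncomputable def stdFrob (K : Type u) [Field K] (p : ℕ) [Fact p.Prime] [CharP K p] :
    AddMonoid.End (InvPoly K) :=
  Finsupp.liftAddHom fun n =>
    (Finsupp.singleAddHom (p • n + Finsupp.equivFunOnFinite.symm fun _ => p - 1)).comp
      (frobenius K p).toAddMonoidHom

/-- `E_S` for `S = K⟦x, y, z⟧ / I`: the inverse polynomials annihilated by `I`. -/
noncomputable abbrev hull {K : Type u} [Field K] (I : Ideal (PS K)) : Submodule (PS K) (InvPoly K) :=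
  Submodule.torsionBySet (PS K) (InvPoly K) (I : Set (PS K))

end InversePolynomials

end FrobeniusMaps

namespace FrobeniusMaps

/-!
The pairing of a power series with an inverse polynomial, the coefficient of `x⁻¹ y⁻¹ z⁻¹` in their
product, makes `E` the continuous dual of `R = K⟦x, y, z⟧` for the `𝔪`-adic topology. So a linear
map from an ideal of `R` to `E` is a functional on that ideal, continuous by Artin–Rees, and
extending the functional to `R` proves that `E` is injective. The monomial `x⁻¹ y⁻¹ z⁻¹` spans a
copy of the residue field meeting every nonzero submodule; since `E_S` contains it, both properties
pass to `S`.

Every functional on `E_S` that is semilinear along a power of the Frobenius map of `K` is the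
pairing with a power series, and the series whose pairing vanishes on `E_S` form the extension of
`I` along that power. Sorting exponents by their remainders modulo `p ^ e` reduces the maps of `E_S`
to such functionals. Hence every element of `ℱ^e(E_S)` is `a f ^ e` for some `a`, and `b f ^ e`
vanishes on `E_S` if and only if `b ∈ I^[p^e]`, so that `a f ^ e` preserves `E_S` if and only if
`a ∈ K_e`. Because `(a f ^ i) (b f ^ j) = a b ^ (p ^ i) f ^ (i + j)`, the coefficients of the sums
of products of elements of degrees `β₁, …, βₛ` are the elements of `K_{β₁} K_{β₂}^[p^β₁] ⋯`.
-/

section InjectiveHull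

open IsLocalRing Submodule

variable {A : Type u} [CommRing A]

theorem baer_torsionBySet {M : Type v} [AddCommGroup M] [Module A M] (hM : Module.Baer A M)
    (I : Ideal A) : Module.Baer (A ⧸ I) (torsionBySet A M (I : Set A)) := by
  intro J g
  let g' : J.comap (Ideal.Quotient.mk I) →ₗ[A] M :=
    { toFun := fun x => g ⟨Ideal.Quotient.mk I x, x.2⟩
      map_add' := fun x y => congrArg Subtype.val (map_add g ⟨_, x.2⟩ ⟨_, y.2⟩)
      map_smul' := fun a x => by
        have := map_smul g (Ideal.Quotient.mk I a) ⟨_, x.2⟩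
        rw [torsionBySet.mk_smul] at this
        exact congrArg Subtype.val this }
  obtain ⟨h, hh⟩ := hM _ g'
  have h_apply : ∀ a, h a = a • h 1 := fun a => by rw [← map_smul, smul_eq_mul, mul_one]
  have h_one_mem : h 1 ∈ torsionBySet A M (I : Set A) := by
    rw [mem_torsionBySet_iff]
    rintro ⟨a, ha : a ∈ I⟩
    have ha' : Ideal.Quotient.mk I a = 0 := Ideal.Quotient.eq_zero_iff_mem.2 ha
    have haJ : a ∈ J.comap (Ideal.Quotient.mk I) := by
      rw [Ideal.mem_comap, ha']
      exact J.zero_mem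
    have hg'a : g' ⟨a, haJ⟩ = g 0 := congrArg (fun x => (g x : M)) (Subtype.ext ha')
    rw [← h_apply, hh a haJ, hg'a, map_zero, Submodule.coe_zero]
  refine ⟨LinearMap.toSpanSingleton _ _ ⟨h 1, h_one_mem⟩, fun x hx => ?_⟩
  obtain ⟨a, rfl⟩ := Ideal.Quotient.mk_surjective x
  rw [LinearMap.toSpanSingleton_apply, torsionBySet.mk_smul]
  exact Subtype.ext ((h_apply a).symm.trans (hh a hx))

theorem isLocalRing_quotient [IsLocalRing A] {I : Ideal A} (hI : I ≠ ⊤) : IsLocalRing (A ⧸ I) :=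
  have := Ideal.Quotient.nontrivial_iff.2 hI
  .of_surjective' _ Ideal.Quotient.mk_surjective

variable [IsLocalRing A] {M : Type u} [AddCommGroup M] [Module A M]

theorem isInjectiveHull_residueField_iff :
    IsInjectiveHull A (ResidueField A) M ↔ Module.Injective A M ∧
      ∃ v : M, v ≠ 0 ∧ (∀ a ∈ maximalIdeal A, a • v = 0) ∧ ∀ m ≠ 0, ∃ a : A, a • m = v := by
  refine and_congr_right fun _ => ⟨?_, ?_⟩
  · rintro ⟨j, hj, hess⟩
    refine ⟨j 1, fun h => one_ne_zero (hj (h.trans (map_zero j).symm)), fun a ha => ?_,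
      fun m hm => ?_⟩
    · have : a • (1 : ResidueField A) = 0 := by
        rw [Algebra.smul_def, mul_one]
        exact (residue_eq_zero_iff a).2 ha
      rw [← map_smul, this, map_zero]
    · have hspan : span A {m} ≠ ⊥ := by simpa using hm
      obtain ⟨_, ⟨hU, x, rfl⟩, hx⟩ := exists_mem_ne_zero_of_ne_bot (hess _ hspan)
      obtain ⟨a, ha⟩ := mem_span_singleton.1 hU
      have hx0 : x ≠ 0 := by rintro rfl; exact hx (map_zero j)
      obtain ⟨c, hc⟩ := residue_surjective x⁻¹
      refine ⟨c * a, ?_⟩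
      rw [mul_smul, ha, ← map_smul, Algebra.smul_def, ResidueField.algebraMap_eq, hc,
        inv_mul_cancel₀ hx0]
  · rintro ⟨v, hv, hann, hess⟩
    let j : ResidueField A →ₗ[A] M :=
      (maximalIdeal A).liftQ (LinearMap.toSpanSingleton A M v) fun a ha => by
        simpa using hann a ha
    have hj : ∀ a : A, j (residue A a) = a • v := fun _ => rfl
    refine ⟨j, (injective_iff_map_eq_zero j).2 fun x hx => ?_, fun U hU => ?_⟩
    · obtain ⟨a, rfl⟩ := residue_surjective x
      refine (residue_eq_zero_iff a).2 fun ha => hv ?_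
      rwa [hj, ha.smul_eq_zero] at hx
    · obtain ⟨m, hmU, hm⟩ := exists_mem_ne_zero_of_ne_bot hU
      obtain ⟨a, rfl⟩ := hess m hm
      exact (Submodule.ne_bot_iff _).2 ⟨a • m, ⟨U.smul_mem a hmU, 1, by simpa using hj 1⟩, hv⟩

theorem isInjectiveHull_torsionBySet {I : Ideal A} [IsLocalRing (A ⧸ I)]
    (hM : IsInjectiveHull A (ResidueField A) M) :
    IsInjectiveHull (A ⧸ I) (ResidueField (A ⧸ I)) (torsionBySet A M (I : Set A)) := by
  have hI : I ≠ ⊤ := Ideal.Quotient.nontrivial_iff.1 inferInstance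
  obtain ⟨hinj, v, hv, hann, hess⟩ := isInjectiveHull_residueField_iff.1 hM
  have hvI : v ∈ Submodule.torsionBySet A M (I : Set A) :=
    (mem_torsionBySet_iff _ _).2 fun a => hann a (le_maximalIdeal hI a.2)
  refine isInjectiveHull_residueField_iff.2 ⟨(baer_torsionBySet (.of_injective hinj) I).injective,
    ⟨v, hvI⟩, fun h => hv (congrArg Subtype.val h), fun x hx => ?_, fun m hm => ?_⟩
  · obtain ⟨a, rfl⟩ := Ideal.Quotient.mk_surjective x
    rw [torsionBySet.mk_smul]
    exact Subtype.ext (hann a fun ha => hx (ha.map _))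
  · obtain ⟨a, ha⟩ := hess m fun h => hm (Subtype.ext h)
    exact ⟨Ideal.Quotient.mk I a, by rw [torsionBySet.mk_smul]; exact Subtype.ext ha⟩

end InjectiveHull

section NoetherianRing

variable {A : Type*} [CommRing A] [IsNoetherianRing A]

theorem exists_pow_smul_top_apply_eq_zero {P M : Type*} [AddCommGroup P] [Module A P]
    [Module.Finite A P] [AddCommGroup M] [Module A M] {N : Submodule A P} {g : N →ₗ[A] M}
    {𝔞 : Ideal A} {n : ℕ} (h : 𝔞 ^ n ≤ (LinearMap.range g).annihilator) :
    ∃ c, ∀ x : N, (x : P) ∈ 𝔞 ^ c • (⊤ : Submodule A P) → g x = 0 := by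
  obtain ⟨k, hk⟩ := Ideal.exists_pow_inf_eq_pow_smul 𝔞 N
  refine ⟨n + k, fun x hx => ?_⟩
  have hxN : (x : P) ∈ (𝔞 ^ n • (⊤ : Submodule A N)).map N.subtype := by
    rw [Submodule.map_smul'', Submodule.map_subtype_top]
    have hx' : (x : P) ∈ 𝔞 ^ (n + k) • (⊤ : Submodule A P) ⊓ N := ⟨hx, x.2⟩
    rw [hk _ le_add_self, Nat.add_sub_cancel] at hx'
    exact Submodule.smul_mono le_rfl inf_le_right hx'
  obtain ⟨y, hy, hyx⟩ := hxN
  obtain rfl : y = x := Subtype.ext hyx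
  have hgy : g y ∈ 𝔞 ^ n • LinearMap.range g := by
    rw [← Submodule.map_top, ← Submodule.map_smul'']
    exact ⟨y, hy, rfl⟩
  have hbot := Submodule.smul_mono_left h hgy
  rwa [Submodule.annihilator_smul, Submodule.mem_bot] at hbot

theorem mem_of_forall_mem_sup_maximalIdeal_pow [IsLocalRing A] {J : Ideal A} {x : A}
    (h : ∀ n, x ∈ J ⊔ IsLocalRing.maximalIdeal A ^ n) : x ∈ J := by
  rw [← Submodule.Quotient.mk_eq_zero]
  refine IsHausdorff.haus (I := IsLocalRing.maximalIdeal A) inferInstance _ fun n => ?_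
  rw [SModEq.zero, ← Submodule.range_mkQ J, ← Submodule.map_top, ← Submodule.map_smul'',
    smul_eq_mul, Ideal.mul_top]
  obtain ⟨y, hy, z, hz, rfl⟩ := Submodule.mem_sup.1 (h n)
  exact ⟨z, hz, by simpa using (Submodule.Quotient.mk_eq_zero J).2 hy⟩

end NoetherianRing

theorem exists_linearMap_extending_vanishing {F V M : Type*} [Field F] [AddCommGroup V]
    [Module F V] [AddCommGroup M] [Module F M] {W U : Submodule F V} (ℓ : W →ₗ[F] M)
    (h : ∀ x : W, (x : V) ∈ U → ℓ x = 0) :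
    ∃ μ : V →ₗ[F] M, (∀ x : W, μ x = ℓ x) ∧ ∀ x ∈ U, μ x = 0 := by
  let f : V →ₗ.[F] M := ⟨W, ℓ⟩
  let g : V →ₗ.[F] M := ⟨U, 0⟩
  have hfg : ∀ (x : f.domain) (y : g.domain), (x : V) = y → f x = g y :=
    fun x y hxy => h x (hxy ▸ y.2)
  obtain ⟨μ, hμ⟩ := LinearMap.exists_extend (f.sup g hfg).toFun
  refine ⟨μ, fun x => ?_, fun x hx => ?_⟩
  · exact (LinearMap.congr_fun hμ _).trans
      ((f.left_le_sup g hfg).2 (y := ⟨x, Submodule.mem_sup_left x.2⟩) (x := x) rfl).symm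
  · exact (LinearMap.congr_fun hμ _).trans
      ((f.right_le_sup g hfg).2 (y := ⟨x, Submodule.mem_sup_right hx⟩) (x := ⟨x, hx⟩) rfl).symm

section PowerSeries

open IsLocalRing MvPowerSeries

variable {σ R : Type*} [CommRing R]

theorem mem_span_range_X_pow {N : ℕ} (s : Finset σ) (f : MvPowerSeries σ R)
    (hf : ∀ n : σ →₀ ℕ, (∀ i ∈ s, n i < N) → coeff n f = 0) :
    f ∈ Ideal.span (Set.range (X : σ → MvPowerSeries σ R)) ^ N := by
  classical
  induction s using Finset.induction_on generalizing f with
  | empty =>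
    obtain rfl : f = 0 := MvPowerSeries.ext fun n => by simpa using hf n (by simp)
    exact zero_mem _
  | insert i s _ ih =>
    let g : MvPowerSeries σ R := fun n => if n i < N then coeff n f else 0
    have coeff_g : ∀ n, coeff n g = if n i < N then coeff n f else 0 := fun _ => rfl
    have hg : g ∈ Ideal.span (Set.range (X : σ → MvPowerSeries σ R)) ^ N := by
      refine ih g fun n hn => ?_
      rw [coeff_g]
      split_ifs with h
      · exact hf n (by simpa [h] using hn)
      · rfl
    have hX : X i ^ N ∣ f - g := X_pow_dvd_iff.2 fun n hn => by
      rw [map_sub, coeff_g, if_pos hn, sub_self]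
    have hfg : f - g ∈ Ideal.span (Set.range (X : σ → MvPowerSeries σ R)) ^ N :=
      Ideal.mem_of_dvd _ hX (Ideal.pow_mem_pow (Ideal.subset_span (Set.mem_range_self i)) N)
    simpa using add_mem hfg hg

theorem coeff_sum_monomial [DecidableEq σ] (s : Finset (σ →₀ ℕ)) (c : (σ →₀ ℕ) → R) (n : σ →₀ ℕ) :
    coeff n (∑ k ∈ s, monomial k (c k)) = if n ∈ s then c n else 0 := by
  simp [coeff_monomial]

variable {F : Type*} [Field F]

theorem mem_maximalIdeal_iff_coeff_zero {f : MvPowerSeries σ F} :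
    f ∈ maximalIdeal (MvPowerSeries σ F) ↔ coeff 0 f = 0 := by
  rw [mem_maximalIdeal, mem_nonunits_iff, isUnit_iff_constantCoeff, isUnit_iff_ne_zero, not_not,
    coeff_zero_eq_constantCoeff_apply]

variable [Finite σ]

theorem maximalIdeal_eq_span_range_X :
    maximalIdeal (MvPowerSeries σ F) = Ideal.span (Set.range X) := by
  have := Fintype.ofFinite σ
  refine le_antisymm (fun f hf => ?_) (Ideal.span_le.2 ?_)
  · rw [← pow_one (Ideal.span _)]
    refine mem_span_range_X_pow Finset.univ f fun n hn => ?_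
    obtain rfl : n = 0 := by ext i; simpa using hn i
    exact mem_maximalIdeal_iff_coeff_zero.1 hf
  · rintro _ ⟨i, rfl⟩
    exact mem_maximalIdeal_iff_coeff_zero.2 (by simp)

theorem exists_forall_le_coeff_eq_zero_mem_maximalIdeal_pow (N : ℕ) :
    ∃ d : σ →₀ ℕ, ∀ f : MvPowerSeries σ F, (∀ n ≤ d, coeff n f = 0) →
      f ∈ maximalIdeal (MvPowerSeries σ F) ^ N := by
  have := Fintype.ofFinite σ
  refine ⟨Finsupp.equivFunOnFinite.symm fun _ => N, fun f hf => ?_⟩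
  rw [maximalIdeal_eq_span_range_X]
  exact mem_span_range_X_pow Finset.univ f fun n hn =>
    hf n fun i => (hn i (Finset.mem_univ i)).le

theorem mem_ideal_of_forall_exists_coeff_eq {J : Ideal (MvPowerSeries σ F)}
    {f : MvPowerSeries σ F} (h : ∀ d : σ →₀ ℕ, ∃ g ∈ J, ∀ n ≤ d, coeff n f = coeff n g) :
    f ∈ J := by
  refine mem_of_forall_mem_sup_maximalIdeal_pow fun N => ?_
  obtain ⟨d, hd⟩ := exists_forall_le_coeff_eq_zero_mem_maximalIdeal_pow (σ := σ) (F := F) N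
  obtain ⟨g, hg, hfg⟩ := h d
  exact Submodule.mem_sup.2
    ⟨g, hg, f - g, hd _ fun n hn => by rw [map_sub, hfg n hn, sub_self], by ring⟩

end PowerSeries

section TwistedPairing

open MvPowerSeries

variable {σ K L : Type*}

/-- The additive pairing of power series over `L` with inverse polynomials over `K` given by a ring
homomorphism `φ : K →+* L`. For `φ = id` it is the coefficient of `g • m` at the exponent `0`; for
`φ` a power of Frobenius it computes the coefficients of `b • f ^ e m`. -/
noncomputable def twistedPairing [Semiring K] [Semiring L] (φ : K →+* L) (g : MvPowerSeries σ L) :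
    ((σ →₀ ℕ) →₀ K) →+ L :=
  Finsupp.liftAddHom fun k => (AddMonoidHom.mulLeft (coeff k g)).comp φ.toAddMonoidHom

section Semiring

variable [Semiring K] [Semiring L] (φ : K →+* L)

@[simp]
theorem twistedPairing_single (g : MvPowerSeries σ L) (k : σ →₀ ℕ) (c : K) :
    twistedPairing φ g (Finsupp.single k c) = coeff k g * φ c :=
  Finsupp.liftAddHom_apply_single _ _ _

@[simp]
theorem twistedPairing_zero : twistedPairing φ (0 : MvPowerSeries σ L) = 0 :=
  Finsupp.addHom_ext fun k c => by simp

theorem twistedPairing_monomial (n : σ →₀ ℕ) (c : L) (m : (σ →₀ ℕ) →₀ K) :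
    twistedPairing φ (monomial n c) m = c * φ (m n) := by
  classical
  induction m using Finsupp.induction_linear with
  | zero => simp
  | add m m' hm hm' => rw [map_add, hm, hm', Finsupp.add_apply, map_add, mul_add]
  | single k d =>
    rw [twistedPairing_single, coeff_monomial, Finsupp.single_apply]
    split_ifs <;> simp

theorem twistedPairing_map (g : MvPowerSeries σ K) (m : (σ →₀ ℕ) →₀ K) :
    twistedPairing φ (map φ g) m = φ (twistedPairing (.id K) g m) := by
  induction m using Finsupp.induction_linear with
  | zero => simp
  | add m m' hm hm' => simp only [map_add, hm, hm']
  | single k c => simp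

end Semiring

theorem exists_eq_twistedPairing [Field K] [CommSemiring L] {φ : K →+* L}
    {W : Submodule K ((σ →₀ ℕ) →₀ K)} (ℓ : W →ₛₗ[φ] L) :
    ∃ g : MvPowerSeries σ L, ∀ m : W, ℓ m = twistedPairing φ g m := by
  obtain ⟨Q, hQ⟩ := W.exists_isCompl
  let ψ : ((σ →₀ ℕ) →₀ K) →ₛₗ[φ] L := ℓ.comp (W.projectionOnto Q hQ)
  let g : MvPowerSeries σ L := fun k => ψ (Finsupp.single k 1)
  have hψ : ψ.toAddMonoidHom = twistedPairing φ g := Finsupp.addHom_ext fun k c => by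
    rw [twistedPairing_single, mul_comm, ← Finsupp.smul_single_one]
    exact map_smulₛₗ ψ c _
  refine ⟨g, fun m => ?_⟩
  rw [← hψ, ← congrArg ℓ (Submodule.projectionOnto_apply_left hQ m)]
  rfl

theorem mem_span_of_forall_dotProduct_eq_zero {ι : Type*} [Fintype ι] [Field K] [CommRing L]
    (φ : K →+* L) {W : Submodule K (ι → K)} {v : ι → L}
    (h : ∀ m : ι → K, (∀ w ∈ W, w ⬝ᵥ m = 0) → v ⬝ᵥ (φ ∘ m) = 0) :
    v ∈ Submodule.span L ((φ ∘ ·) '' (W : Set (ι → K))) := by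
  classical
  obtain ⟨Q, hQ⟩ := W.exists_isCompl
  let w : ι → ι → K := fun j => W.projection Q hQ (Pi.single j 1)
  have proj_apply : ∀ u ∈ W, ∀ i, ∑ j, u j * w j i = u i := by
    intro u hu i
    conv_rhs => rw [← Submodule.projection_apply_of_mem_left hQ hu, pi_eq_sum_univ' u]
    simp [w]
  -- Each `Pi.single i 1 - (w · i)` is orthogonal to `W`, so `v` is orthogonal to its image.
  have v_eq : v = ∑ j, v j • (φ ∘ w j) := by
    ext i
    have hi := h (fun j => (Pi.single i 1 : ι → K) j - w j i) fun u hu => by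
      simp only [dotProduct, mul_sub, Finset.sum_sub_distrib, proj_apply u hu]
      simp [Pi.single_apply]
    simp only [dotProduct, Function.comp_apply, map_sub, mul_sub, Finset.sum_sub_distrib,
      sub_eq_zero] at hi
    simpa [Pi.single_apply] using hi
  rw [v_eq]
  exact sum_mem fun j _ =>
    Submodule.smul_mem _ _ (Submodule.subset_span ⟨w j, Submodule.coe_mem _, rfl⟩)

end TwistedPairing

section InversePolynomials

open IsLocalRing MvPowerSeries

variable {K : Type u} [Field K]

theorem smul_single_apply (a : PS K) (k : Fin 3 →₀ ℕ) (c : K) (n : Fin 3 →₀ ℕ) :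
    (a • (Finsupp.single k c : InvPoly K)) n = if n ≤ k then coeff (k - n) a * c else 0 := by
  classical
  change invPolyMul a (Finsupp.single k c) n = _
  rw [invPolyMul_single, Finsupp.finsetSum_apply]
  simp only [Finsupp.single_apply]
  split_ifs with h
  · rw [Finset.sum_eq_single_of_mem (k - n, n)
      (Finset.HasAntidiagonal.mem_antidiagonal.2 (tsub_add_cancel_of_le h)), if_pos rfl]
    rintro ⟨d, n'⟩ hd hne
    refine if_neg ?_
    rintro rfl
    exact hne (by rw [← Finset.HasAntidiagonal.mem_antidiagonal.1 hd, add_tsub_cancel_right])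
  · refine Finset.sum_eq_zero fun q hq => if_neg ?_
    rintro rfl
    exact h (Finset.HasAntidiagonal.mem_antidiagonal.1 hq ▸ le_add_self)

theorem smul_apply (a : PS K) (m : InvPoly K) (n : Fin 3 →₀ ℕ) :
    (a • m) n = twistedPairing (.id K) (monomial n 1 * a) m := by
  classical
  induction m using Finsupp.induction_linear with
  | zero => rw [smul_zero, Finsupp.zero_apply, map_zero]
  | add m m' hm hm' => rw [smul_add, Finsupp.add_apply, hm, hm', map_add]
  | single k c =>
    simp only [smul_single_apply, twistedPairing_single, coeff_monomial_mul, one_mul, ite_mul,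
      zero_mul, RingHom.id_apply]

theorem smul_apply_zero (a : PS K) (m : InvPoly K) :
    (a • m) 0 = twistedPairing (.id K) a m := by
  rw [smul_apply, monomial_zero_one, one_mul]

theorem monomial_smul_apply (d : Fin 3 →₀ ℕ) (m : InvPoly K) (n : Fin 3 →₀ ℕ) :
    (monomial d (1 : K) • m) n = m (d + n) := by
  rw [smul_apply, monomial_mul_monomial, twistedPairing_monomial, mul_one, one_mul, add_comm,
    RingHom.id_apply]

instance : IsScalarTower K (PS K) (InvPoly K) :=
  .of_algebraMap_smul fun c m => Finsupp.ext fun n => by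
    change ((C c : PS K) • m) n = _
    rw [smul_apply, ← monomial_zero_eq_C_apply, monomial_mul_monomial, twistedPairing_monomial,
      add_zero, one_mul, RingHom.id_apply, Finsupp.smul_apply, smul_eq_mul]

theorem mem_hull {I : Ideal (PS K)} {m : InvPoly K} : m ∈ hull I ↔ ∀ a ∈ I, a • m = 0 := by
  simp [hull, Submodule.mem_torsionBySet_iff]

theorem mem_hull_of_twistedPairing {I : Ideal (PS K)} {m : InvPoly K}
    (h : ∀ a ∈ I, twistedPairing (.id K) a m = 0) : m ∈ hull I :=
  mem_hull.2 fun a ha => Finsupp.ext fun n => by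
    rw [smul_apply, h _ (I.mul_mem_left _ ha), Finsupp.zero_apply]

/-- The linear map taking a power series to the family of its coefficients at the exponents in a
finite set `s`. -/
noncomputable def coeffsOn {σ : Type*} (R : Type*) [Semiring R] (s : Finset (σ →₀ ℕ)) :
    MvPowerSeries σ R →ₗ[R] (s → R) :=
  .pi fun k => coeff k.1

@[simp]
theorem coeffsOn_apply {σ R : Type*} [Semiring R] (s : Finset (σ →₀ ℕ)) (f : MvPowerSeries σ R)
    (k : s) : coeffsOn R s f k = coeff k.1 f := rfl

theorem mem_map_of_twistedPairing_eq_zero {L : Type*} [Field L] {φ : K →+* L} {I : Ideal (PS K)}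
    {g : MvPowerSeries (Fin 3) L} (hg : ∀ m ∈ hull I, twistedPairing φ g m = 0) :
    g ∈ I.map (map (σ := Fin 3) φ) := by
  refine mem_ideal_of_forall_exists_coeff_eq fun d => ?_
  obtain ⟨s, hs⟩ : ∃ s : Finset (Fin 3 →₀ ℕ), ∀ n ≤ d, n ∈ s := ⟨.Iic d, by simp⟩
  let W := (I.restrictScalars K).map (coeffsOn K s)
  have hspan : coeffsOn L s g ∈ Submodule.span L ((φ ∘ ·) '' (W : Set (s → K))) := by
    refine mem_span_of_forall_dotProduct_eq_zero φ fun c hc => ?_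
    let m : InvPoly K := ∑ k : s, Finsupp.single k.1 (c k)
    have hm : m ∈ hull I := mem_hull_of_twistedPairing fun a ha => by
      simpa [m, dotProduct] using hc _ (Submodule.mem_map_of_mem ha)
    simpa [m, dotProduct] using hg m hm
  have hW : Submodule.span L ((φ ∘ ·) '' (W : Set (s → K))) ≤
      ((I.map (map (σ := Fin 3) φ)).restrictScalars L).map (coeffsOn L s) := by
    rw [Submodule.span_le]
    rintro _ ⟨_, ⟨a, ha, rfl⟩, rfl⟩
    exact ⟨map φ a, Ideal.mem_map_of_mem _ ha, by ext k; simp⟩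
  obtain ⟨b, hb, hbg⟩ := hW hspan
  exact ⟨b, hb, fun n hn => (congrFun hbg ⟨n, hs n hn⟩).symm⟩

end InversePolynomials

section InversePolynomialsInjective

open IsLocalRing MvPowerSeries

variable {K : Type u} [Field K]

theorem exists_X_pow_smul_eq_zero (m : InvPoly K) (i : Fin 3) :
    ∃ N : ℕ, (X i : PS K) ^ N • m = 0 := by
  refine ⟨m.support.sup (fun n => n i) + 1, Finsupp.ext fun j => ?_⟩
  rw [X_pow_eq, monomial_smul_apply, Finsupp.zero_apply]
  by_contra h
  have := Finset.le_sup (f := fun n : Fin 3 →₀ ℕ => n i) (Finsupp.mem_support_iff.2 h)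
  rw [Finsupp.add_apply, Finsupp.single_eq_same] at this
  omega

theorem exists_maximalIdeal_pow_le_annihilator {U : Submodule (PS K) (InvPoly K)} (hU : U.FG) :
    ∃ N : ℕ, maximalIdeal (PS K) ^ N ≤ U.annihilator := by
  induction U, hU using Submodule.fg_induction with
  | singleton m =>
    refine Ideal.exists_pow_le_of_le_radical_of_fg ?_ (IsNoetherian.noetherian _)
    rw [maximalIdeal_eq_span_range_X, Ideal.span_le]
    rintro _ ⟨i, rfl⟩
    obtain ⟨N, hN⟩ := exists_X_pow_smul_eq_zero m i
    exact ⟨N, (Submodule.mem_annihilator_span_singleton _ _).2 hN⟩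
  | sup U₁ U₂ _ _ ih₁ ih₂ =>
    obtain ⟨N₁, h₁⟩ := ih₁
    obtain ⟨N₂, h₂⟩ := ih₂
    refine ⟨max N₁ N₂, ?_⟩
    rw [Submodule.annihilator_sup]
    exact le_inf ((Ideal.pow_le_pow_right (le_max_left _ _)).trans h₁)
      ((Ideal.pow_le_pow_right (le_max_right _ _)).trans h₂)

theorem exists_eq_smul_apply_zero {μ : PS K →ₗ[K] K} {N : ℕ}
    (hμ : ∀ r ∈ maximalIdeal (PS K) ^ N, μ r = 0) : ∃ m : InvPoly K, ∀ r, μ r = (r • m) 0 := by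
  classical
  obtain ⟨d, hd⟩ := exists_forall_le_coeff_eq_zero_mem_maximalIdeal_pow (σ := Fin 3) (F := K) N
  refine ⟨∑ k ∈ Finset.Iic d, Finsupp.single k (μ (monomial k 1)), fun r => ?_⟩
  let t : PS K := ∑ k ∈ Finset.Iic d, monomial k (coeff k r)
  have hrt : μ r = μ t := by
    rw [← sub_eq_zero, ← map_sub]
    refine hμ _ (hd _ fun n hn => ?_)
    rw [map_sub, coeff_sum_monomial, if_pos (Finset.mem_Iic.2 hn), sub_self]
  rw [hrt, smul_apply_zero, map_sum, map_sum]
  refine Finset.sum_congr rfl fun k _ => ?_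
  rw [twistedPairing_single, RingHom.id_apply, ← smul_eq_mul, ← map_smul, ← map_smul, smul_eq_mul,
    mul_one]

theorem invPoly_baer : Module.Baer (PS K) (InvPoly K) := by
  intro J g
  obtain ⟨n, hn⟩ := exists_maximalIdeal_pow_le_annihilator (U := LinearMap.range g)
    (by rw [LinearMap.range_eq_map]; exact (IsNoetherian.noetherian (⊤ : Submodule _ J)).map g)
  obtain ⟨c, hc⟩ := exists_pow_smul_top_apply_eq_zero hn
  obtain ⟨μ, hμ, hμ_zero⟩ := exists_linearMap_extending_vanishing
    (W := J.restrictScalars K) (U := (maximalIdeal (PS K) ^ c).restrictScalars K)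
    (Finsupp.lapply 0 ∘ₗ g.restrictScalars K) fun x hx =>
      DFunLike.congr_fun (hc x (by simpa using hx)) 0
  obtain ⟨m, hm⟩ := exists_eq_smul_apply_zero hμ_zero
  refine ⟨LinearMap.toSpanSingleton _ _ m, fun x hx => Finsupp.ext fun k => ?_⟩
  calc (x • m) k = ((monomial k 1 * x) • m) 0 := by rw [mul_smul, monomial_smul_apply, add_zero]
    _ = (g (monomial k (1 : K) • ⟨x, hx⟩)) 0 := by
      rw [← hm]
      exact hμ ⟨_, J.mul_mem_left _ hx⟩
    _ = (g ⟨x, hx⟩) k := by rw [map_smul, monomial_smul_apply, add_zero]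

theorem exists_smul_eq_single_zero_one {m : InvPoly K} (hm : m ≠ 0) :
    ∃ a : PS K, a • m = Finsupp.single 0 1 := by
  classical
  obtain ⟨k, hk⟩ := m.support.exists_maximal (Finsupp.support_nonempty_iff.2 hm)
  refine ⟨monomial k (m k)⁻¹, Finsupp.ext fun n => ?_⟩
  rw [smul_apply, monomial_mul_monomial, twistedPairing_monomial, Finsupp.single_apply, one_mul,
    RingHom.id_apply]
  split_ifs with h
  · rw [← h, zero_add, inv_mul_cancel₀ (Finsupp.mem_support_iff.1 hk.prop)]
  · refine mul_eq_zero_of_right _ (Finsupp.notMem_support_iff.1 fun h' => h ?_)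
    have := hk.le_of_ge h' le_add_self
    simpa [eq_comm] using this

theorem invPoly_isInjectiveHull : IsInjectiveHull (PS K) (ResidueField (PS K)) (InvPoly K) := by
  refine isInjectiveHull_residueField_iff.2 ⟨invPoly_baer.injective, Finsupp.single 0 1, by simp,
    fun a ha => Finsupp.ext fun n => ?_, fun m hm => exists_smul_eq_single_zero_one hm⟩
  rw [smul_single_apply, Finsupp.zero_apply]
  split_ifs
  · rw [zero_tsub, mem_maximalIdeal_iff_coeff_zero.1 ha, zero_mul]
  · rfl

end InversePolynomialsInjective

section FrobeniusPower

variable {R : Type u} [CommRing R]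

theorem pow_mem_frobPower (p : ℕ) {I : Ideal R} {a : R} (ha : a ∈ I) (e : ℕ) :
    a ^ p ^ e ∈ frobPower p I e :=
  Ideal.subset_span ⟨a, ha, rfl⟩

theorem frobPower_le_iff {p : ℕ} {I J : Ideal R} {e : ℕ} :
    frobPower p I e ≤ J ↔ ∀ a ∈ I, a ^ p ^ e ∈ J := by
  rw [frobPower, Ideal.span_le]
  exact ⟨fun h a ha => h ⟨a, ha, rfl⟩, fun h _ ⟨a, ha, hx⟩ => hx ▸ h a ha⟩

theorem frobPower_eq_map_iterateFrobenius (p : ℕ) [ExpChar R p] (I : Ideal R) (e : ℕ) :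
    frobPower p I e = I.map (iterateFrobenius R p e) :=
  le_antisymm (frobPower_le_iff.2 fun _ ha => Ideal.mem_map_of_mem _ ha)
    (Ideal.map_le_iff_le_comap.2 fun _ ha => pow_mem_frobPower p ha e)

end FrobeniusPower

section Remainders

open MvPowerSeries

variable {σ : Type*}

/-- The `r`-th section of `b` modulo `q`: the power series collecting the coefficients of `b` at the
exponents `q • k + r`. For `q ≠ 0` and finite `σ`, `b` is the sum of the
`X ^ r * expand q (sectionMod q r b)` over the remainders `r` of exponents modulo `q`. -/
noncomputable def sectionMod {R : Type*} (q : ℕ) (r : σ →₀ ℕ) (b : MvPowerSeries σ R) :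
    MvPowerSeries σ R :=
  fun k => b (q • k + r)

theorem coeff_sectionMod {R : Type*} [Semiring R] (q : ℕ) (r : σ →₀ ℕ) (b : MvPowerSeries σ R)
    (k : σ →₀ ℕ) : coeff k (sectionMod q r b) = coeff (q • k + r) b := rfl

theorem sectionMod_sum {R ι : Type*} [Semiring R] (q : ℕ) (r : σ →₀ ℕ) (s : Finset ι)
    (b : ι → MvPowerSeries σ R) :
    sectionMod q r (∑ i ∈ s, b i) = ∑ i ∈ s, sectionMod q r (b i) := by
  ext k
  simp only [coeff_sectionMod, map_sum]

variable [Finite σ]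

variable (σ) in
/-- The exponent all of whose entries are `q - 1`: for `q ≠ 0`, the exponents below it are the
possible remainders of exponents modulo `q`. -/
noncomputable def maxRemainder (q : ℕ) : σ →₀ ℕ :=
  Finsupp.equivFunOnFinite.symm fun _ => q - 1

theorem maxRemainder_apply (q : ℕ) (i : σ) : maxRemainder σ q i = q - 1 := rfl

theorem smul_maxRemainder_add_maxRemainder {p q : ℕ} (hp : p ≠ 0) (hq : q ≠ 0) :
    p • maxRemainder σ q + maxRemainder σ p = maxRemainder σ (p * q) := by
  ext i
  simp only [Finsupp.add_apply, Finsupp.smul_apply, maxRemainder_apply, smul_eq_mul]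
  obtain ⟨p, rfl⟩ := Nat.exists_eq_succ_of_ne_zero hp
  obtain ⟨q, rfl⟩ := Nat.exists_eq_succ_of_ne_zero hq
  simp only [Nat.succ_eq_add_one, Nat.mul_succ, Nat.add_sub_cancel]
  omega

theorem lt_of_le_maxRemainder {q : ℕ} (hq : q ≠ 0) {r : σ →₀ ℕ} (hr : r ≤ maxRemainder σ q)
    (i : σ) : r i < q := by
  have := hr i
  rw [maxRemainder_apply] at this
  omega

theorem exists_eq_smul_add_le_maxRemainder {q : ℕ} (hq : q ≠ 0) (n : σ →₀ ℕ) :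
    ∃ k, ∃ r ≤ maxRemainder σ q, n = q • k + r := by
  refine ⟨n.mapRange (· / q) (Nat.zero_div q), n.mapRange (· % q) (Nat.zero_mod q), fun i => ?_, ?_⟩
  · rw [maxRemainder_apply, Finsupp.mapRange_apply]
    exact Nat.le_sub_one_of_lt (Nat.mod_lt _ (Nat.pos_of_ne_zero hq))
  · ext i
    simp [Nat.div_add_mod]

theorem smul_add_eq_smul_add_iff {q : ℕ} (hq : q ≠ 0) {k l r s : σ →₀ ℕ}
    (hr : r ≤ maxRemainder σ q) (hs : s ≤ maxRemainder σ q) :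
    q • k + r = q • l + s ↔ k = l ∧ r = s := by
  refine ⟨fun h => ?_, fun ⟨hkl, hrs⟩ => hkl ▸ hrs ▸ rfl⟩
  have h_apply : ∀ i, q * k i + r i = q * l i + s i := fun i => by
    simpa using DFunLike.congr_fun h i
  have hrs : r = s := Finsupp.ext fun i => by
    have := congrArg (· % q) (h_apply i)
    simpa [Nat.mul_add_mod, Nat.mod_eq_of_lt, lt_of_le_maxRemainder hq hr,
      lt_of_le_maxRemainder hq hs] using this
  refine ⟨Finsupp.ext fun i => ?_, hrs⟩
  subst hrs
  exact Nat.eq_of_mul_eq_mul_left (Nat.pos_of_ne_zero hq) (Nat.add_right_cancel (h_apply i))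

theorem ext_sectionMod {R : Type*} [Semiring R] {q : ℕ} (hq : q ≠ 0) {b b' : MvPowerSeries σ R}
    (h : ∀ r ≤ maxRemainder σ q, sectionMod q r b = sectionMod q r b') : b = b' := by
  ext n
  obtain ⟨k, r, hr, rfl⟩ := exists_eq_smul_add_le_maxRemainder hq n
  rw [← coeff_sectionMod, ← coeff_sectionMod, h r hr]

variable [DecidableEq σ] {R : Type*} [CommRing R] {q : ℕ}

theorem coeff_smul_add_expand (hq : q ≠ 0) (c : MvPowerSeries σ R) (k : σ →₀ ℕ) {r : σ →₀ ℕ}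
    (hr : r ≤ maxRemainder σ q) :
    coeff (q • k + r) (expand q hq c) = if r = 0 then coeff k c else 0 := by
  split_ifs with h
  · rw [h, add_zero, coeff_expand_smul]
  · obtain ⟨i, hi⟩ := DFunLike.ne_iff.1 h
    refine coeff_expand_of_not_dvd q hq c (i := i) fun hdvd => hi ?_
    rw [Finsupp.add_apply, Finsupp.smul_apply, smul_eq_mul, Nat.dvd_add_right ⟨k i, rfl⟩] at hdvd
    exact Nat.eq_zero_of_dvd_of_lt hdvd (lt_of_le_maxRemainder hq hr i)

theorem sectionMod_monomial_mul_expand (hq : q ≠ 0) (c : MvPowerSeries σ R) {r s : σ →₀ ℕ}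
    (hr : r ≤ maxRemainder σ q) (hs : s ≤ maxRemainder σ q) :
    sectionMod q s (monomial r 1 * expand q hq c) = if r = s then c else 0 := by
  ext k
  rw [coeff_sectionMod, coeff_monomial_mul, one_mul]
  by_cases hrs : r = s
  · rw [hrs, if_pos le_add_self, add_tsub_cancel_right, coeff_expand_smul, if_pos rfl]
  · rw [if_neg hrs, map_zero, ite_eq_right_iff]
    intro hle
    obtain ⟨l, t, ht, hlt⟩ := exists_eq_smul_add_le_maxRemainder hq (q • k + s - r)
    rw [hlt, coeff_smul_add_expand hq c l ht, if_neg]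
    rintro rfl
    refine hrs ((smul_add_eq_smul_add_iff (k := l) (l := k) hq hr hs).1 ?_).2
    rw [← add_zero (q • l), ← hlt, tsub_add_cancel_of_le hle]

theorem sectionMod_sum_monomial_mul_expand (hq : q ≠ 0)
    (c : (σ →₀ ℕ) → MvPowerSeries σ R) {s : σ →₀ ℕ} (hs : s ≤ maxRemainder σ q) :
    sectionMod q s (∑ r ∈ Finset.Iic (maxRemainder σ q), monomial r 1 * expand q hq (c r)) =
      c s := by
  rw [sectionMod_sum, Finset.sum_congr rfl fun r hr =>
    sectionMod_monomial_mul_expand hq (c r) (Finset.mem_Iic.1 hr) hs]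
  simp [hs]

theorem eq_sum_monomial_mul_expand_sectionMod (hq : q ≠ 0) (b : MvPowerSeries σ R) :
    b = ∑ r ∈ Finset.Iic (maxRemainder σ q), monomial r 1 * expand q hq (sectionMod q r b) :=
  ext_sectionMod hq fun _ hr => (sectionMod_sum_monomial_mul_expand hq (sectionMod q · b) hr).symm

theorem sectionMod_pow (p : ℕ) [ExpChar R p] (e : ℕ) (a : MvPowerSeries σ R)
    {r : σ →₀ ℕ} (hr : r ≤ maxRemainder σ (p ^ e)) :
    sectionMod (p ^ e) r (a ^ p ^ e) = if r = 0 then map (iterateFrobenius R p e) a else 0 := by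
  ext k
  rw [coeff_sectionMod, ← map_iterateFrobenius_expand p (expChar_ne_zero R p) a e, coeff_map,
    coeff_smul_add_expand _ a k hr]
  split_ifs <;> simp

theorem mem_frobPower_of_forall_sectionMod_mem {R : Type u} {σ : Type v} [Finite σ] [CommRing R]
    {p : ℕ} [ExpChar R p] [ExpChar (MvPowerSeries σ R) p] {I : Ideal (MvPowerSeries σ R)} {e : ℕ}
    {b : MvPowerSeries σ R}
    (h : ∀ r ≤ maxRemainder σ (p ^ e),
      sectionMod (p ^ e) r b ∈ I.map (map (σ := σ) (iterateFrobenius R p e))) :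
    b ∈ frobPower p I e := by
  classical
  have hp := expChar_ne_zero R p
  have hq := pow_ne_zero e hp
  have hfrob : (expand (p ^ e) hq : MvPowerSeries σ R →ₐ[R] _).toRingHom.comp
      (map (iterateFrobenius R p e)) = iterateFrobenius (MvPowerSeries σ R) p e :=
    RingHom.ext fun a => (map_expand _ _ _ _).symm.trans (map_iterateFrobenius_expand p hp a e)
  rw [frobPower_eq_map_iterateFrobenius, ← hfrob, ← Ideal.map_map,
    eq_sum_monomial_mul_expand_sectionMod hq b]
  exact sum_mem fun r hr =>
    Ideal.mul_mem_left _ _ (Ideal.mem_map_of_mem _ (h r (Finset.mem_Iic.1 hr)))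

end Remainders

section Frobenius

open MvPowerSeries

variable {K : Type u} [Field K] (p : ℕ) [Fact p.Prime] [CharP K p]

theorem stdFrob_single (k : Fin 3 →₀ ℕ) (c : K) :
    stdFrob K p (Finsupp.single k c) = Finsupp.single (p • k + maxRemainder (Fin 3) p) (c ^ p) :=
  Finsupp.liftAddHom_apply_single _ _ _

theorem stdFrob_pow_single (e : ℕ) (k : Fin 3 →₀ ℕ) (c : K) :
    (stdFrob K p ^ e) (Finsupp.single k c) =
      Finsupp.single (p ^ e • k + maxRemainder (Fin 3) (p ^ e)) (c ^ p ^ e) := by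
  have hp : p ≠ 0 := (Fact.out : p.Prime).ne_zero
  induction e with
  | zero =>
    have : maxRemainder (Fin 3) 1 = 0 := Finsupp.ext fun _ => rfl
    simp [this]
  | succ e ih =>
    rw [pow_succ', AddMonoid.End.coe_mul, Function.comp_apply, ih, stdFrob_single, smul_add,
      smul_smul, add_assoc, smul_maxRemainder_add_maxRemainder hp (pow_ne_zero e hp), ← pow_mul,
      ← pow_succ, ← pow_succ']

theorem stdFrob_pow_apply (e : ℕ) (m : InvPoly K) (j : Fin 3 →₀ ℕ) {s : Fin 3 →₀ ℕ}
    (hs : s ≤ maxRemainder (Fin 3) (p ^ e)) :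
    (stdFrob K p ^ e) m (p ^ e • j + s) =
      if s = maxRemainder (Fin 3) (p ^ e) then m j ^ p ^ e else 0 := by
  classical
  have hq : p ^ e ≠ 0 := pow_ne_zero e (Fact.out : p.Prime).ne_zero
  induction m using Finsupp.induction_linear with
  | zero => simp [zero_pow hq]
  | add m m' hm hm' =>
    rw [map_add (stdFrob K p ^ e), Finsupp.add_apply, hm, hm', Finsupp.add_apply, add_pow_char_pow]
    split_ifs <;> simp
  | single k c =>
    simp only [stdFrob_pow_single, Finsupp.single_apply, smul_add_eq_smul_add_iff hq le_rfl hs]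
    by_cases hkj : k = j <;> simp [hkj, zero_pow hq, eq_comm]

theorem stdFrob_pow_monomial_smul (e : ℕ) (d : Fin 3 →₀ ℕ) (m : InvPoly K) :
    (stdFrob K p ^ e) (monomial d (1 : K) • m) =
      monomial (p ^ e • d) (1 : K) • (stdFrob K p ^ e) m := by
  ext n
  obtain ⟨j, s, hs, rfl⟩ :=
    exists_eq_smul_add_le_maxRemainder (pow_ne_zero e (Fact.out : p.Prime).ne_zero) n
  rw [monomial_smul_apply, ← add_assoc, ← smul_add, stdFrob_pow_apply p e _ _ hs,
    stdFrob_pow_apply p e _ _ hs, monomial_smul_apply]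

theorem smul_stdFrob_pow_apply (e : ℕ) (b : PS K) (m : InvPoly K) {r : Fin 3 →₀ ℕ}
    (hr : r ≤ maxRemainder (Fin 3) (p ^ e)) :
    (b • (stdFrob K p ^ e) m) (maxRemainder (Fin 3) (p ^ e) - r) =
      twistedPairing (iterateFrobenius K p e) (sectionMod (p ^ e) r b) m := by
  induction m using Finsupp.induction_linear with
  | zero => simp
  | add m m' hm hm' => rw [map_add, smul_add, Finsupp.add_apply, hm, hm', map_add]
  | single k c =>
    rw [stdFrob_pow_single, smul_single_apply, if_pos (tsub_le_self.trans le_add_self),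
      add_tsub_assoc_of_le tsub_le_self, tsub_tsub_cancel_of_le hr, twistedPairing_single,
      coeff_sectionMod, iterateFrobenius_def]

theorem smul_stdFrob_pow_smul_add_apply (e : ℕ) (b : PS K) (m : InvPoly K) (j : Fin 3 →₀ ℕ)
    {s : Fin 3 →₀ ℕ} (hs : s ≤ maxRemainder (Fin 3) (p ^ e)) :
    (b • (stdFrob K p ^ e) m) (p ^ e • j + s) =
      twistedPairing (iterateFrobenius K p e)
        (sectionMod (p ^ e) (maxRemainder (Fin 3) (p ^ e) - s) b) (monomial j (1 : K) • m) := by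
  rw [← monomial_smul_apply, smul_comm, ← stdFrob_pow_monomial_smul,
    ← smul_stdFrob_pow_apply p e b _ tsub_le_self, tsub_tsub_cancel_of_le hs]

theorem stdFrob_pow_smul (e : ℕ) (a : PS K) (m : InvPoly K) :
    (stdFrob K p ^ e) (a • m) = a ^ p ^ e • (stdFrob K p ^ e) m := by
  ext n
  obtain ⟨j, s, hs, rfl⟩ :=
    exists_eq_smul_add_le_maxRemainder (pow_ne_zero e (Fact.out : p.Prime).ne_zero) n
  have hs_iff : maxRemainder (Fin 3) (p ^ e) - s = 0 ↔ s = maxRemainder (Fin 3) (p ^ e) := by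
    rw [tsub_eq_zero_iff_le, hs.ge_iff_eq]
  rw [stdFrob_pow_apply p e _ _ hs, smul_stdFrob_pow_smul_add_apply p e _ _ _ hs,
    sectionMod_pow p e a tsub_le_self]
  simp only [hs_iff]
  split_ifs
  · rw [twistedPairing_map, ← smul_apply_zero, smul_comm, monomial_smul_apply, add_zero,
      iterateFrobenius_def]
  · rw [twistedPairing_zero, AddMonoidHom.zero_apply]

end Frobenius

section Representation

open MvPowerSeries

theorem frobMaps_apply_smul {A : Type u} [CommRing A] {M : Type v} [AddCommGroup M] [Module A M]
    {p : ℕ} {I : Ideal A} {e : ℕ} {φ : AddMonoid.End (Submodule.torsionBySet A M (I : Set A))}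
    (hφ : φ ∈ frobMaps (A ⧸ I) p (Submodule.torsionBySet A M (I : Set A)) e) (a : A)
    (m : Submodule.torsionBySet A M (I : Set A)) : φ (a • m) = a ^ p ^ e • φ m := by
  have := hφ (Ideal.Quotient.mk I a) m
  rwa [← map_pow, Submodule.torsionBySet.mk_smul, Submodule.torsionBySet.mk_smul] at this

variable {K : Type u} [Field K] {p : ℕ} [Fact p.Prime] [CharP K p] {I : Ideal (PS K)} {e : ℕ}

instance expChar_powerSeries : ExpChar (PS K) p :=
  expChar_of_injective_ringHom (MvPowerSeries.C_injective (σ := Fin 3) (R := K)) p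

theorem mem_frobPower_of_smul_stdFrob_pow_eq_zero {b : PS K}
    (hb : ∀ m ∈ hull I, b • (stdFrob K p ^ e) m = 0) : b ∈ frobPower p I e :=
  mem_frobPower_of_forall_sectionMod_mem fun r hr =>
    mem_map_of_twistedPairing_eq_zero fun m hm => by
      rw [← smul_stdFrob_pow_apply p e b m hr, hb m hm, Finsupp.zero_apply]

theorem smul_stdFrob_pow_eq_zero {b : PS K} (hb : b ∈ frobPower p I e) {m : InvPoly K}
    (hm : m ∈ hull I) : b • (stdFrob K p ^ e) m = 0 := by
  have hle : frobPower p I e ≤ Ideal.torsionOf (PS K) (InvPoly K) ((stdFrob K p ^ e) m) :=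
    frobPower_le_iff.2 fun a ha => by
      rw [Ideal.mem_torsionOf_iff, ← stdFrob_pow_smul, mem_hull.1 hm a ha, map_zero]
  exact hle hb

theorem mem_colonIdeal_iff {a : PS K} :
    a ∈ colonIdeal p I e ↔ ∀ m ∈ hull I, a • (stdFrob K p ^ e) m ∈ hull I := by
  simp only [colonIdeal, Submodule.mem_colon, mem_hull, smul_smul, smul_eq_mul]
  constructor
  · intro ha m hm b hb
    rw [mul_comm]
    exact smul_stdFrob_pow_eq_zero (ha b hb) (mem_hull.2 hm)
  · intro ha b hb
    refine mem_frobPower_of_smul_stdFrob_pow_eq_zero fun m hm => ?_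
    rw [mul_comm]
    exact ha m (mem_hull.1 hm) b hb

theorem exists_eq_smul_stdFrob_pow {φ : AddMonoid.End (hull I)}
    (hφ : φ ∈ frobMaps (PS K ⧸ I) p (hull I) e) :
    ∃ a : PS K, ∀ m : hull I, (φ m : InvPoly K) = a • (stdFrob K p ^ e) (m : InvPoly K) := by
  have hq : p ^ e ≠ 0 := pow_ne_zero e (Fact.out : p.Prime).ne_zero
  have φ_smul (c : K) (m : hull I) :
      (φ (c • m) : InvPoly K) = iterateFrobenius K p e c • (φ m : InvPoly K) := by
    rw [← algebraMap_smul (PS K) c m, frobMaps_apply_smul hφ, ← map_pow, Submodule.coe_smul,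
      algebraMap_smul, iterateFrobenius_def]
  let ℓ (n : Fin 3 →₀ ℕ) : (hull I).restrictScalars K →ₛₗ[iterateFrobenius K p e] K :=
    { toFun m := (φ m : InvPoly K) n
      map_add' m m' := congrArg (fun m : hull I => (m : InvPoly K) n) (map_add φ m m')
      map_smul' c m := DFunLike.congr_fun (φ_smul c m) n }
  -- Section `r` of the coefficient has to represent reading off the entry at `maxRemainder - r`.
  choose g hg using fun r => exists_eq_twistedPairing (ℓ (maxRemainder (Fin 3) (p ^ e) - r))
  let a : PS K := ∑ r ∈ Finset.Iic (maxRemainder (Fin 3) (p ^ e)),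
    monomial r 1 * expand (p ^ e) hq (g r)
  refine ⟨a, fun m => Finsupp.ext fun n => ?_⟩
  obtain ⟨j, s, hs, rfl⟩ := exists_eq_smul_add_le_maxRemainder hq n
  rw [smul_stdFrob_pow_smul_add_apply p e a m j hs,
    sectionMod_sum_monomial_mul_expand hq g tsub_le_self]
  refine Eq.trans ?_ (hg (maxRemainder (Fin 3) (p ^ e) - s) (monomial j (1 : K) • m))
  change _ = (φ (monomial j (1 : K) • m) : InvPoly K) _
  rw [frobMaps_apply_smul hφ, monomial_pow, one_pow, Submodule.coe_smul, monomial_smul_apply,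
    tsub_tsub_cancel_of_le hs]

end Representation

section ColonProducts

variable {R : Type u} [CommRing R] (p : ℕ)

/-- The product `K_{β₁} K_{β₂}^[p^β₁] K_{β₃}^[p^(β₁ + β₂)] ⋯` of a list of exponents, by recursion
on the list: all factors but the first carry a common Frobenius power `[p^β₁]`. -/
def colonProd (I : Ideal R) : List ℕ → Ideal R
  | [] => 1
  | β :: l => colonIdeal p I β * frobPower p (colonProd I l) β

/-- The analogue of the ideal `L_e` in degree `d`: the sum of the products of colon ideals over all
compositions of `d` into parts `< e`. -/
def lIdealLT (I : Ideal R) (e d : ℕ) : Ideal R :=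
  ⨆ (l : List ℕ) (_ : (∀ β ∈ l, 1 ≤ β ∧ β < e) ∧ l.sum = d), colonProd p I l

theorem colonProd_le_lIdealLT (I : Ideal R) {e d : ℕ} {l : List ℕ}
    (hl : ∀ β ∈ l, 1 ≤ β ∧ β < e) (hd : l.sum = d) : colonProd p I l ≤ lIdealLT p I e d :=
  le_iSup₂_of_le l ⟨hl, hd⟩ le_rfl

theorem lIdealLT_zero (I : Ideal R) (e : ℕ) : lIdealLT p I e 0 = ⊤ :=
  top_le_iff.1 (Ideal.one_eq_top.symm.le.trans
    (colonProd_le_lIdealLT p I (l := []) (List.forall_mem_nil _) List.sum_nil))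

theorem mul_frobPower_le {A B C : Ideal R} {e : ℕ} :
    A * frobPower p B e ≤ C ↔ ∀ a ∈ A, ∀ b ∈ B, a * b ^ p ^ e ∈ C := by
  refine ⟨fun h a ha b hb => h (Ideal.mul_mem_mul ha (pow_mem_frobPower p hb e)), fun h => ?_⟩
  refine Ideal.mul_le.2 fun a ha b hb => ?_
  have hle : frobPower p B e ≤ C.colon {a} := frobPower_le_iff.2 fun c hc => by
    rw [Submodule.mem_colon_singleton, smul_eq_mul, mul_comm]
    exact h a ha c hc
  rw [mul_comm]
  exact Submodule.mem_colon_singleton.1 (hle hb)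

variable [ExpChar R p]

theorem frobPower_zero (I : Ideal R) : frobPower p I 0 = I := by
  rw [frobPower_eq_map_iterateFrobenius, iterateFrobenius_zero, Ideal.map_id]

theorem frobPower_add (I : Ideal R) (d e : ℕ) :
    frobPower p I (d + e) = frobPower p (frobPower p I e) d := by
  simp only [frobPower_eq_map_iterateFrobenius, Ideal.map_map, iterateFrobenius_add]

theorem frobPower_one (e : ℕ) : frobPower p (1 : Ideal R) e = 1 := by
  rw [frobPower_eq_map_iterateFrobenius, Ideal.one_eq_top, Ideal.map_top]

theorem frobPower_mul (I J : Ideal R) (e : ℕ) :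
    frobPower p (I * J) e = frobPower p I e * frobPower p J e := by
  simp only [frobPower_eq_map_iterateFrobenius, Ideal.map_mul]

theorem frobPower_prod {ι : Type*} (s : Finset ι) (J : ι → Ideal R) (e : ℕ) :
    frobPower p (∏ i ∈ s, J i) e = ∏ i ∈ s, frobPower p (J i) e := by
  simp only [frobPower_eq_map_iterateFrobenius]
  exact map_prod (Ideal.mapHom (iterateFrobenius R p e)) J s

theorem frobPower_iSup {ι : Sort*} (J : ι → Ideal R) (e : ℕ) :
    frobPower p (⨆ i, J i) e = ⨆ i, frobPower p (J i) e := by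
  simp only [frobPower_eq_map_iterateFrobenius, Ideal.map_iSup]

theorem colonProd_append (I : Ideal R) (l l' : List ℕ) :
    colonProd p I (l ++ l') = colonProd p I l * frobPower p (colonProd p I l') l.sum := by
  induction l with
  | nil => simp only [List.nil_append, colonProd, List.sum_nil, frobPower_zero, one_mul]
  | cons β l ih =>
    rw [List.cons_append, colonProd, ih, colonProd, frobPower_mul, List.sum_cons, frobPower_add,
      mul_assoc]

theorem prod_frobPower_colonIdeal (I : Ideal R) (l : List ℕ) :
    ∏ i : Fin l.length, frobPower p (colonIdeal p I (l.get i)) (l.take i).sum =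
      colonProd p I l := by
  induction l with
  | nil => simp [colonProd]
  | cons β l ih =>
    rw [colonProd, ← ih, frobPower_prod]
    refine (Fin.prod_univ_succ (n := l.length) _).trans ?_
    simp [frobPower_zero, frobPower_add]

theorem lIdeal_eq_lIdealLT (I : Ideal R) (e : ℕ) : lIdeal p I e = lIdealLT p I e e := by
  refine le_antisymm (iSup₂_le fun c hc => ?_) (iSup₂_le fun l hl => ?_)
  · refine (prod_frobPower_colonIdeal p I c.blocks).le.trans
      (colonProd_le_lIdealLT p I (fun β hβ => ⟨c.blocks_pos hβ, ?_⟩) c.blocks_sum)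
    obtain ⟨i, rfl⟩ := List.get_of_mem hβ
    exact hc i
  · refine (prod_frobPower_colonIdeal p I l).ge.trans ?_
    exact le_iSup₂_of_le (⟨l, fun {i} hi => (hl.1 i hi).1, hl.2⟩ : Composition e)
      (fun i => (hl.1 _ (List.get_mem l i)).2) le_rfl

theorem colonIdeal_le_lIdealLT (I : Ideal R) {e d : ℕ} (hd : d < e) :
    colonIdeal p I d ≤ lIdealLT p I e d := by
  rcases Nat.eq_zero_or_pos d with rfl | hd_pos
  · exact le_top.trans (lIdealLT_zero p I e).ge
  · have hle := colonProd_le_lIdealLT p I (List.forall_mem_singleton.2 ⟨hd_pos, hd⟩)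
      List.sum_singleton
    simpa only [colonProd, frobPower_one, mul_one] using hle

theorem lIdealLT_mul_frobPower_le (I : Ideal R) (e d d' : ℕ) :
    lIdealLT p I e d * frobPower p (lIdealLT p I e d') d ≤ lIdealLT p I e (d + d') := by
  simp only [lIdealLT, frobPower_iSup, Ideal.iSup_mul, Ideal.mul_iSup]
  refine iSup₂_le fun l' hl' => iSup₂_le fun l hl => ?_
  rw [← hl.2, ← colonProd_append]
  exact colonProd_le_lIdealLT p I (List.forall_mem_append.2 ⟨hl.1, hl'.1⟩)
    (by rw [List.sum_append, hl.2, hl'.2])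

end ColonProducts

section Degrees

variable {K : Type u} [Field K] {p : ℕ} [Fact p.Prime] [CharP K p] {I : Ideal (PS K)}

variable (p) in
/-- The map `φ` on `E_S` is the restriction of `a f ^ d`, where `f` is the standard Frobenius
map. -/
def IsSmulStdFrobPow (d : ℕ) (a : PS K) (φ : AddMonoid.End (hull I)) : Prop :=
  ∀ m : hull I, (φ m : InvPoly K) = a • (stdFrob K p ^ d) (m : InvPoly K)

namespace IsSmulStdFrobPow

variable {d d' : ℕ} {a b : PS K} {φ ψ : AddMonoid.End (hull I)}

theorem zero : IsSmulStdFrobPow p d 0 (0 : AddMonoid.End (hull I)) := fun m => by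
  rw [zero_smul]
  rfl

theorem one : IsSmulStdFrobPow p 0 1 (1 : AddMonoid.End (hull I)) := fun m => by
  rw [one_smul]
  rfl

theorem add (hφ : IsSmulStdFrobPow p d a φ) (hψ : IsSmulStdFrobPow p d b ψ) :
    IsSmulStdFrobPow p d (a + b) (φ + ψ) := fun m => by
  rw [add_smul, ← hφ, ← hψ]
  rfl

theorem neg (hφ : IsSmulStdFrobPow p d a φ) : IsSmulStdFrobPow p d (-a) (-φ) := fun m => by
  rw [neg_smul, ← hφ]
  rfl

theorem sum {ι : Type*} {s : Finset ι} {a : ι → PS K} {φ : ι → AddMonoid.End (hull I)}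
    (h : ∀ i ∈ s, IsSmulStdFrobPow p d (a i) (φ i)) :
    IsSmulStdFrobPow p d (∑ i ∈ s, a i) (∑ i ∈ s, φ i) := by
  classical
  induction s using Finset.induction_on with
  | empty => exact zero
  | insert i s hi ih =>
    rw [Finset.sum_insert hi, Finset.sum_insert hi]
    exact (h i (s.mem_insert_self i)).add (ih fun j hj => h j (Finset.mem_insert_of_mem hj))

theorem mul (hφ : IsSmulStdFrobPow p d a φ) (hψ : IsSmulStdFrobPow p d' b ψ) :
    IsSmulStdFrobPow p (d + d') (a * b ^ p ^ d) (φ * ψ) := fun m => by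
  rw [pow_add, AddMonoid.End.coe_mul, AddMonoid.End.coe_mul, Function.comp_apply, hφ, hψ,
    stdFrob_pow_smul, mul_smul, Function.comp_apply]

end IsSmulStdFrobPow

theorem exists_isSmulStdFrobPow {d : ℕ} (φ : frobMaps (PS K ⧸ I) p (hull I) d) :
    ∃ a ∈ colonIdeal p I d, IsSmulStdFrobPow p d a (φ : AddMonoid.End (hull I)) := by
  obtain ⟨a, ha⟩ := exists_eq_smul_stdFrob_pow φ.2
  exact ⟨a, mem_colonIdeal_iff.2 fun m hm => ha ⟨m, hm⟩ ▸ Subtype.property _, ha⟩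

theorem exists_frobMaps_isSmulStdFrobPow {d : ℕ} {a : PS K} (ha : a ∈ colonIdeal p I d) :
    ∃ φ : frobMaps (PS K ⧸ I) p (hull I) d,
      IsSmulStdFrobPow p d a (φ : AddMonoid.End (hull I)) := by
  let φ : AddMonoid.End (hull I) :=
    AddMonoidHom.mk' (fun m => ⟨a • (stdFrob K p ^ d) m, mem_colonIdeal_iff.1 ha m m.2⟩)
      fun m m' => Subtype.ext <| by
        simp only [Submodule.coe_add, map_add (stdFrob K p ^ d), smul_add]
  refine ⟨⟨φ, fun s m => ?_⟩, fun m => rfl⟩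
  obtain ⟨b, rfl⟩ := Ideal.Quotient.mk_surjective s
  rw [← map_pow, Submodule.torsionBySet.mk_smul, Submodule.torsionBySet.mk_smul]
  refine Subtype.ext ?_
  change a • (stdFrob K p ^ d) (b • (m : InvPoly K)) = b ^ p ^ d • a • (stdFrob K p ^ d) m
  rw [stdFrob_pow_smul, smul_comm]

theorem exists_mem_lIdealLT_of_mem_frobAlgLT {e : ℕ} {x : FrobAlg (PS K ⧸ I) p (hull I)}
    (hx : x ∈ frobAlgLT (PS K ⧸ I) p (hull I) e) (d : ℕ) :
    ∃ a ∈ lIdealLT p I e d, IsSmulStdFrobPow p d a (x d : AddMonoid.End (hull I)) := by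
  induction hx using Subring.closure_induction generalizing d with
  | mem x hx =>
    obtain ⟨i, φ, hi, rfl⟩ := hx
    rcases eq_or_ne d i with rfl | hd
    · obtain ⟨a, ha, hφ⟩ := exists_isSmulStdFrobPow φ
      exact ⟨a, colonIdeal_le_lIdealLT p I hi ha, by rwa [DirectSum.of_eq_same]⟩
    · exact ⟨0, zero_mem _, by rw [DirectSum.of_eq_of_ne _ _ _ hd]; exact .zero⟩
  | zero => exact ⟨0, zero_mem _, .zero⟩
  | one =>
    rw [DirectSum.one_def]
    rcases eq_or_ne d 0 with rfl | hd
    · exact ⟨1, lIdealLT_zero p I e ▸ Submodule.mem_top, by rw [DirectSum.of_eq_same]; exact .one⟩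
    · exact ⟨0, zero_mem _, by rw [DirectSum.of_eq_of_ne _ _ _ hd]; exact .zero⟩
  | add x y _ _ hx hy =>
    obtain ⟨a, ha, hxa⟩ := hx d
    obtain ⟨b, hb, hyb⟩ := hy d
    exact ⟨a + b, add_mem ha hb, hxa.add hyb⟩
  | neg x _ hx =>
    obtain ⟨a, ha, hxa⟩ := hx d
    exact ⟨-a, neg_mem ha, hxa.neg⟩
  | mul x y _ _ hx hy =>
    choose a ha hxa using hx
    choose b hb hyb using hy
    have hcoe : (((x * y) d : frobMaps (PS K ⧸ I) p (hull I) d) : AddMonoid.End (hull I)) =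
        ∑ ij ∈ Finset.HasAntidiagonal.antidiagonal d, (x ij.1 : AddMonoid.End (hull I)) * y ij.2 :=
      DirectSum.coe_mul_apply_eq_sum_antidiagonal _ x y d
    refine ⟨∑ ij ∈ Finset.HasAntidiagonal.antidiagonal d, a ij.1 * b ij.2 ^ p ^ ij.1,
      sum_mem ?_, ?_⟩
    · rintro ⟨i, j⟩ hij
      rw [← Finset.HasAntidiagonal.mem_antidiagonal.1 hij]
      exact (mul_frobPower_le p).1 (lIdealLT_mul_frobPower_le p I e i j) _ (ha i) _ (hb j)
    · rw [hcoe]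
      refine .sum fun ⟨i, j⟩ hij => ?_
      rw [← Finset.HasAntidiagonal.mem_antidiagonal.1 hij]
      exact (hxa i).mul (hyb j)

variable (p) in
/-- `a f ^ d` lies in the subalgebra of the Frobenius maps of `E_S` generated in degrees `< e`. -/
def IsGenCoeff (I : Ideal (PS K)) (e d : ℕ) (a : PS K) : Prop :=
  ∃ φ : frobMaps (PS K ⧸ I) p (hull I) d,
    DirectSum.of (fun j => frobMaps (PS K ⧸ I) p (hull I) j) d φ ∈
      frobAlgLT (PS K ⧸ I) p (hull I) e ∧
    IsSmulStdFrobPow p d a (φ : AddMonoid.End (hull I))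

theorem IsGenCoeff.zero {e d : ℕ} : IsGenCoeff p I e d 0 :=
  ⟨0, by rw [map_zero]; exact zero_mem _, .zero⟩

theorem IsGenCoeff.add {e d : ℕ} {a b : PS K} (ha : IsGenCoeff p I e d a)
    (hb : IsGenCoeff p I e d b) : IsGenCoeff p I e d (a + b) := by
  obtain ⟨φ, hφ, hφa⟩ := ha
  obtain ⟨ψ, hψ, hψb⟩ := hb
  exact ⟨φ + ψ, by rw [map_add]; exact add_mem hφ hψ, hφa.add hψb⟩

theorem IsGenCoeff.mul_pow {e d d' : ℕ} {a b : PS K} (ha : IsGenCoeff p I e d a)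
    (hb : IsGenCoeff p I e d' b) : IsGenCoeff p I e (d + d') (a * b ^ p ^ d) := by
  obtain ⟨φ, hφ, hφa⟩ := ha
  obtain ⟨ψ, hψ, hψb⟩ := hb
  have hφψ := mul_mem hφ hψ
  rw [DirectSum.of_mul_of] at hφψ
  exact ⟨_, hφψ, hφa.mul hψb⟩

theorem isGenCoeff_of_mem_colonIdeal {e d : ℕ} (hd : d < e) {a : PS K}
    (ha : a ∈ colonIdeal p I d) : IsGenCoeff p I e d a := by
  obtain ⟨φ, hφ⟩ := exists_frobMaps_isSmulStdFrobPow ha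
  exact ⟨φ, Subring.subset_closure ⟨d, φ, hd, rfl⟩, hφ⟩

theorem isGenCoeff_zero_degree {e : ℕ} (he : 1 ≤ e) (a : PS K) : IsGenCoeff p I e 0 a :=
  isGenCoeff_of_mem_colonIdeal he <| mem_colonIdeal_iff.2 fun _ hm => (hull I).smul_mem a hm

variable (p I) in
/-- The ideal of the coefficients `a` for which `a f ^ d` lies in the subalgebra generated in
degrees `< e`. -/
def genCoeffIdeal {e : ℕ} (he : 1 ≤ e) (d : ℕ) : Ideal (PS K) where
  carrier := {a | IsGenCoeff p I e d a}
  zero_mem' := .zero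
  add_mem' := .add
  smul_mem' r a ha := by
    have hra := (isGenCoeff_zero_degree he r).mul_pow ha
    rwa [zero_add, pow_zero, pow_one] at hra

theorem colonProd_le_genCoeffIdeal {e : ℕ} (he : 1 ≤ e) {l : List ℕ} (hl : ∀ β ∈ l, β < e) :
    colonProd p I l ≤ genCoeffIdeal p I he l.sum := by
  induction l with
  | nil => exact fun a _ => isGenCoeff_zero_degree he a
  | cons β l ih =>
    rw [List.forall_mem_cons] at hl
    rw [colonProd, List.sum_cons, mul_frobPower_le]
    exact fun a ha b hb => (isGenCoeff_of_mem_colonIdeal hl.1 ha).mul_pow (ih hl.2 hb)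

theorem isGenCoeff_of_mem_lIdealLT {e d : ℕ} (he : 1 ≤ e) {a : PS K}
    (ha : a ∈ lIdealLT p I e d) : IsGenCoeff p I e d a := by
  have hle : lIdealLT p I e d ≤ genCoeffIdeal p I he d := iSup₂_le fun l hl =>
    hl.2 ▸ colonProd_le_genCoeffIdeal he fun β hβ => (hl.1 β hβ).2
  exact hle ha

end Degrees

end FrobeniusMaps

theorem mainTheorem2 {K : Type u} [Field K] (p : ℕ) [Fact p.Prime] [CharP K p]
    (I : Ideal (FrobeniusMaps.PS K)) :
    -- the built modules `E` and `E_S` are injective hulls of the residue fields of `R` and `S`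
    FrobeniusMaps.IsInjectiveHull (FrobeniusMaps.PS K)
      (IsLocalRing.ResidueField (FrobeniusMaps.PS K)) (FrobeniusMaps.InvPoly K) ∧
    (I ≠ ⊤ → ∃ _ : IsLocalRing (FrobeniusMaps.PS K ⧸ I),
      FrobeniusMaps.IsInjectiveHull (FrobeniusMaps.PS K ⧸ I)
        (IsLocalRing.ResidueField (FrobeniusMaps.PS K ⧸ I)) (FrobeniusMaps.hull I)) ∧
    -- the degree `e` part of the subalgebra generated in degrees `< e` is `L_e f^e`
    ∀ e : ℕ, 1 ≤ e →
      {ψ : FrobeniusMaps.hull I → FrobeniusMaps.InvPoly K |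
        ∃ φ : FrobeniusMaps.frobMaps (FrobeniusMaps.PS K ⧸ I) p (FrobeniusMaps.hull I) e,
          DirectSum.of
              (fun j => FrobeniusMaps.frobMaps (FrobeniusMaps.PS K ⧸ I) p (FrobeniusMaps.hull I) j)
              e φ ∈
            FrobeniusMaps.frobAlgLT (FrobeniusMaps.PS K ⧸ I) p (FrobeniusMaps.hull I) e ∧
          ψ = fun m => ((φ : AddMonoid.End (FrobeniusMaps.hull I)) m : FrobeniusMaps.InvPoly K)} =
      {ψ : FrobeniusMaps.hull I → FrobeniusMaps.InvPoly K |
        ∃ a ∈ FrobeniusMaps.lIdeal p I e,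
          ψ = fun m : FrobeniusMaps.hull I =>
            a • (FrobeniusMaps.stdFrob K p ^ e) (m : FrobeniusMaps.InvPoly K)} := by
  refine ⟨FrobeniusMaps.invPoly_isInjectiveHull, fun hI => ?_, fun e he => ?_⟩
  · have := FrobeniusMaps.isLocalRing_quotient hI
    exact ⟨this, FrobeniusMaps.isInjectiveHull_torsionBySet FrobeniusMaps.invPoly_isInjectiveHull⟩
  · ext ψ
    rw [FrobeniusMaps.lIdeal_eq_lIdealLT]
    constructor
    · rintro ⟨φ, hφ, rfl⟩
      obtain ⟨a, ha, hφa⟩ := FrobeniusMaps.exists_mem_lIdealLT_of_mem_frobAlgLT hφ e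
      rw [DirectSum.of_eq_same] at hφa
      exact ⟨a, ha, funext hφa⟩
    · rintro ⟨a, ha, rfl⟩
      obtain ⟨φ, hφ, hφa⟩ := FrobeniusMaps.isGenCoeff_of_mem_lIdealLT he ha
      exact ⟨φ, hφ, (funext hφa).symm⟩
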